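/- Let $K$ be a field of characteristic $0$ and $P=K[x_1,\dots,x_n]$ with its standard grading. For an ideal $I\subseteq P$ let $\mathrm{LT}(I)$ be the ideal generated by the leading terms of the nonzero elements of $I$ with respect to the degree reverse lexicographic order with $x_1>\dots>x_n$. For a homogeneous ideal $I\subseteq P$, the generic initial ideal $\mathrm{rgin}(I)$ is the (unique, monomial) ideal $J$ for which there is a nonempty Zariski-open set $U\subseteq \mathrm{GL}(n,K)$ such that $\mathrm{LT}(g(I))=J$ for all $g\in U$, where $g$ acts on $P$ by the corresponding linear change of coordinates. The minimal generators of a monomial ideal are the monomials it contains none of whose proper divisors it contains. Let $I$ be a homogeneous ideal of $P$ that is generated by homogeneous polynomials of degree $\le\delta+1$, where $\delta\in\mathbb{N}$, and let $i\le n$. If $\mathrm{rgin}(I)$ has no minimal generators of degree $\delta+1$ in $K[x_1,\dots,x_i]$, then $\mathrm{rgin}(I)$ has no minimal generators of any degree $>\delta$ in $K[x_1,\dots,x_i]$. -/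

import Mathlib

open MvPolynomial

noncomputable section

/-- Type synonym of `Fin n →₀ ℕ` carrying the degree reverse lexicographic order. -/
def DegRevLexSyn (n : ℕ) : Type := Fin n →₀ ℕ

namespace DegRevLexSyn

variable {n : ℕ}

instance : AddCommMonoid (DegRevLexSyn n) :=
  inferInstanceAs (AddCommMonoid (Fin n →₀ ℕ))

/-- Exponents are compared first by total degree and then lexicographically by the negated
exponents, read from the last variable to the first one. -/
def key (a : Fin n →₀ ℕ) : ℕ ×ₗ Lex (Fin n → ℤ) :=
  toLex (a.degree, toLex (fun j => -(a j.rev : ℤ)))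

lemma key_injective : Function.Injective (key (n := n)) := by
  intro a b h
  have h2 := congrArg (fun z => ofLex (ofLex z).2) h
  ext j
  have h3 := congrFun h2 j.rev
  simpa [key] using h3

instance : LinearOrder (DegRevLexSyn n) :=
  LinearOrder.lift' (fun a : DegRevLexSyn n => key (n := n) a) key_injective

/-- `a < b` iff `a` has smaller total degree, or the degrees agree and, at the last index where
`a` and `b` differ, the exponent of `a` is the larger one. -/
lemma key_lt_iff {a b : Fin n →₀ ℕ} : key a < key b ↔
    a.degree < b.degree ∨ (a.degree = b.degree ∧ ∃ j, (∀ k, j < k → a k = b k) ∧ b j < a j) := by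
  rw [key, key, Prod.Lex.toLex_lt_toLex]
  refine or_congr Iff.rfl (and_congr Iff.rfl ?_)
  constructor
  · rintro ⟨j, h1, h2⟩
    refine ⟨j.rev, fun k hk => ?_, ?_⟩
    · have := h1 k.rev (by simpa using Fin.rev_lt_rev.2 hk)
      simpa using this
    · simpa using h2
  · rintro ⟨j, h1, h2⟩
    refine ⟨j.rev, fun k hk => ?_, ?_⟩
    · have := h1 k.rev (by rwa [← Fin.rev_lt_rev, Fin.rev_rev])
      simpa using this
    · simpa using h2

lemma key_add_lt {a b : Fin n →₀ ℕ} (h : key a < key b) (c : Fin n →₀ ℕ) :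
    key (a + c) < key (b + c) := by
  rw [key_lt_iff] at h ⊢
  rcases h with h | ⟨h, j, h1, h2⟩
  · left; simpa using h
  · right
    refine ⟨by simp [h], j, fun k hk => by simp [h1 k hk], by simpa using h2⟩

lemma key_monotone : Monotone (key (n := n)) := by
  intro a b h
  rcases eq_or_ne a b with rfl | hne
  · exact le_rfl
  refine le_of_lt (key_lt_iff.2 (Or.inl ?_))
  obtain ⟨c, rfl⟩ := exists_add_of_le h
  have hc : c ≠ 0 := by rintro rfl; simp at hne
  have : c.degree ≠ 0 := by rwa [Ne, Finsupp.degree_eq_zero_iff]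
  simp only [map_add]
  omega

instance : IsOrderedAddMonoid (DegRevLexSyn n) where
  add_le_add_left a b h c := by
    rcases eq_or_lt_of_le h with rfl | h
    · exact le_rfl
    · exact le_of_lt (key_add_lt (n := n) h c)

instance : WellFoundedLT (DegRevLexSyn n) := by
  rw [← wellQuasiOrderedLE_iff_wellFoundedLT]
  refine ⟨fun f => ?_⟩
  obtain ⟨i, j, hij, h⟩ := wellQuasiOrdered_le (α := Fin n →₀ ℕ) f
  exact ⟨i, j, hij, key_monotone h⟩

end DegRevLexSyn

/-- The degree reverse lexicographic order on the monomials in `n` variables, with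
`X 0 > X 1 > ⋯ > X (n - 1)`. -/
def degRevLex (n : ℕ) : MonomialOrder (Fin n) where
  syn := DegRevLexSyn n
  toSyn := { toEquiv := Equiv.refl (Fin n →₀ ℕ), map_add' := fun _ _ => rfl }
  toSyn_monotone := fun _ _ h => DegRevLexSyn.key_monotone h

open scoped MonomialOrder in
lemma degRevLex_lt_iff {n : ℕ} {a b : Fin n →₀ ℕ} : a ≺[degRevLex n] b ↔
    a.degree < b.degree ∨ (a.degree = b.degree ∧ ∃ j, (∀ k, j < k → a k = b k) ∧ b j < a j) :=
  DegRevLexSyn.key_lt_iff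

section GenericInitialIdeal

variable {n : ℕ} {K : Type*} [Field K]

/-- The ideal generated by the leading terms of the nonzero elements of `I`. -/
def initialIdeal (m : MonomialOrder (Fin n)) (I : Ideal (MvPolynomial (Fin n) K)) :
    Ideal (MvPolynomial (Fin n) K) :=
  Ideal.span (m.leadingTerm '' {f | f ∈ I ∧ f ≠ 0})

/-- The linear change of coordinates `X j ↦ ∑ k, g k j • X k`. -/
def changeCoords (g : GL (Fin n) K) : MvPolynomial (Fin n) K →ₐ[K] MvPolynomial (Fin n) K :=
  aeval (fun j => ∑ k, C ((g : Matrix (Fin n) (Fin n) K) k j) * X k)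

/-- `U ⊆ GL(n, K)` is Zariski open: its complement is the zero locus in `GL(n, K)` of a set of
polynomials in the matrix entries. -/
def IsZariskiOpenGL (U : Set (GL (Fin n) K)) : Prop :=
  ∃ S : Set (MvPolynomial (Fin n × Fin n) K),
    U = {g : GL (Fin n) K | ∃ p ∈ S, eval (fun e => (g : Matrix (Fin n) (Fin n) K) e.1 e.2) p ≠ 0}

/-- `J` is the generic initial ideal of `I` with respect to `m`: the initial ideal of `g(I)` is
`J` for all `g` in some nonempty Zariski-open subset of `GL(n, K)`. -/
def IsGin (m : MonomialOrder (Fin n)) (I J : Ideal (MvPolynomial (Fin n) K)) : Prop :=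
  ∃ U : Set (GL (Fin n) K), IsZariskiOpenGL U ∧ U.Nonempty ∧
    ∀ g ∈ U, initialIdeal m (I.map (changeCoords g)) = J

/-- `J = rgin(I)`: the generic initial ideal for the degree reverse lexicographic order. -/
def IsRgin (I J : Ideal (MvPolynomial (Fin n) K)) : Prop :=
  IsGin (degRevLex n) I J

/-- Nonempty Zariski-open subsets of `GL(n, K)` meet when `K` is infinite. -/
lemma IsZariskiOpenGL.inter_nonempty [Infinite K] {U V : Set (GL (Fin n) K)}
    (hU : IsZariskiOpenGL U) (hV : IsZariskiOpenGL V) (hU' : U.Nonempty) (hV' : V.Nonempty) :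
    (U ∩ V).Nonempty := by
  obtain ⟨S, rfl⟩ := hU
  obtain ⟨T, rfl⟩ := hV
  obtain ⟨a, p, hp, hpa⟩ := hU'
  obtain ⟨b, q, hq, hqb⟩ := hV'
  have hp0 : p ≠ 0 := by rintro rfl; simp at hpa
  have hq0 : q ≠ 0 := by rintro rfl; simp at hqb
  have hne : p * q * (Matrix.mvPolynomialX (Fin n) (Fin n) K).det ≠ 0 :=
    mul_ne_zero (mul_ne_zero hp0 hq0) (Matrix.det_mvPolynomialX_ne_zero _ _)
  obtain ⟨x, hx⟩ : ∃ x, eval x (p * q * (Matrix.mvPolynomialX (Fin n) (Fin n) K).det) ≠ 0 := by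
    by_contra! h
    exact hne (MvPolynomial.funext (by simpa using h))
  simp only [map_mul, mul_ne_zero_iff] at hx
  obtain ⟨⟨hx1, hx2⟩, hx3⟩ := hx
  let A : Matrix (Fin n) (Fin n) K := fun i j => x (i, j)
  have hA : A.det ≠ 0 := by
    rw [RingHom.map_det] at hx3
    convert hx3 using 2
    ext i j
    simp [A, Matrix.mvPolynomialX]
  refine ⟨Matrix.GeneralLinearGroup.mkOfDetNeZero A hA, ⟨p, hp, hx1⟩, ⟨q, hq, hx2⟩⟩

/-- The generic initial ideal is unique. -/
lemma IsGin.unique [Infinite K] {m : MonomialOrder (Fin n)}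
    {I J J' : Ideal (MvPolynomial (Fin n) K)} (h : IsGin m I J) (h' : IsGin m I J') : J = J' := by
  obtain ⟨U, hU, hUne, hUJ⟩ := h
  obtain ⟨V, hV, hVne, hVJ⟩ := h'
  obtain ⟨g, hgU, hgV⟩ := hU.inter_nonempty hV hUne hVne
  rw [← hUJ g hgU, ← hVJ g hgV]

attribute [local instance] MvPolynomial.gradedAlgebra in
/-- `I` is a homogeneous ideal for the standard grading. -/
def IsHomogeneousIdeal (I : Ideal (MvPolynomial (Fin n) K)) : Prop :=
  I.IsHomogeneous (homogeneousSubmodule (Fin n) K)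

/-- `I` is generated by homogeneous polynomials of degree at most `e`. -/
def GeneratedInDegreeLE (I : Ideal (MvPolynomial (Fin n) K)) (e : ℕ) : Prop :=
  ∃ S : Set (MvPolynomial (Fin n) K),
    (∀ f ∈ S, ∃ d ≤ e, f.IsHomogeneous d) ∧ I = Ideal.span S

/-- For a monomial ideal `J`: the monomial with exponent `a` is one of the minimal (monomial)
generators of `J`, i.e. it lies in `J` and no proper divisor of it does. -/
def IsMinimalGenerator (J : Ideal (MvPolynomial (Fin n) K)) (a : Fin n →₀ ℕ) : Prop :=
  Minimal (fun b => monomial b (1 : K) ∈ J) a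

/-- The monomial ideal `J` has a minimal generator of degree `d` that lies in the polynomial
ring in the first `i` variables. -/
def HasMinimalGeneratorIn (J : Ideal (MvPolynomial (Fin n) K)) (i d : ℕ) : Prop :=
  ∃ a : Fin n →₀ ℕ, IsMinimalGenerator J a ∧ a.degree = d ∧ ∀ j ∈ a.support, (j : ℕ) < i

end GenericInitialIdeal

end

/-! Fix `g` in the open set and put `L = g(I)`, so that `J` is the initial ideal of `L`. Call a
monomial low if it involves only the first `i` variables.

Two facts drive the proof. In characteristic zero `J` is strongly stable
(`IsGin.monomial_add_single_mem`). For degrevlex, a form whose leading monomial is not low lies in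
the ideal of the high variables (`mem_highIdeal_of_degree`), so one may compute modulo that ideal.

Choose a monic form in `L` for each low monomial of degree `δ` in `J`, and multiply it only by its
last variable and later low ones. By strong stability this yields exactly one form `h u` for every
low multiple `u` of those monomials. If there are no low minimal generators in degree `δ + 1`, every
low leading monomial of `L` in that degree is such a multiple, so the products of the degree `δ`
forms with the remaining variables reduce to zero. As for Pommaret bases, this propagates to all
degrees (`X_mul_mem`). Since `L` is generated in degrees at most `δ + 1`, the family and the high
ideal together span all forms of `L` of degree above `δ` (`mem_spanOn_lowMultiples`). Hence every
low leading monomial there has a divisor of degree `δ` in `J` (`degree_mem_of_mem_spanOn`), and is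
not minimal. -/

open scoped MonomialOrder

/-! ### Monomials of initial ideals. -/

section InitialMonomials

variable {n : ℕ} {K : Type*} [Field K] {m : MonomialOrder (Fin n)}
  {L : Ideal (MvPolynomial (Fin n) K)}

lemma monomial_mem_initialIdeal_iff {u : Fin n →₀ ℕ} :
    monomial u (1 : K) ∈ initialIdeal m L ↔ ∃ f ∈ L, f ≠ 0 ∧ m.degree f ≤ u := by
  rw [initialIdeal, MonomialOrder.span_leadingTerm_eq_span_monomial₀, ← Set.image_image
    (fun s => monomial s (1 : K)) m.degree, mem_ideal_span_monomial_image]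
  · constructor
    · intro h
      obtain ⟨s, ⟨f, ⟨⟨hf, hf0⟩, -⟩, rfl⟩, hs⟩ := h u (by classical simp [support_monomial])
      exact ⟨f, hf, hf0, hs⟩
    · rintro ⟨f, hf, hf0, hu⟩ v hv
      classical
      simp only [support_monomial, one_ne_zero, if_false, Finset.mem_singleton] at hv
      subst hv
      exact ⟨_, ⟨f, ⟨⟨hf, hf0⟩, by simpa using hf0⟩, rfl⟩, hu⟩
  · rintro p ⟨-, hp⟩
    exact Or.inl (isUnit_iff_ne_zero.2 (by simpa using hp))

lemma monomial_degree_mem_initialIdeal {f : MvPolynomial (Fin n) K} (hf : f ∈ L) (hf0 : f ≠ 0) :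
    monomial (m.degree f) (1 : K) ∈ initialIdeal m L :=
  monomial_mem_initialIdeal_iff.2 ⟨f, hf, hf0, le_rfl⟩

attribute [local instance] MvPolynomial.gradedAlgebra in
lemma homogeneousComponent_mem_span {S : Set (MvPolynomial (Fin n) K)}
    (hS : ∀ f ∈ S, ∃ d, f.IsHomogeneous d) {f : MvPolynomial (Fin n) K}
    (hf : f ∈ Ideal.span S) (d : ℕ) : homogeneousComponent d f ∈ Ideal.span S := by
  refine homogeneousComponent_mem_of_mem (Ideal.homogeneous_span _ _ ?_) hf d
  intro x hx
  exact hS x hx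

/-- A monomial of the initial ideal of a homogeneous ideal is the leading monomial of a monic
form in the ideal. -/
lemma exists_monic_form_of_mem_initialIdeal
    (hL : ∀ f ∈ L, ∀ d, homogeneousComponent d f ∈ L) {u : Fin n →₀ ℕ}
    (hu : monomial u (1 : K) ∈ initialIdeal m L) :
    ∃ f ∈ L, f.IsHomogeneous u.degree ∧ m.Monic f ∧ m.degree f = u := by
  classical
  obtain ⟨f, hf, hf0, hfu⟩ := monomial_mem_initialIdeal_iff.1 hu
  obtain ⟨v, rfl⟩ := exists_add_of_le hfu
  set c := m.leadingCoeff f with hc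
  have hc0 : c ≠ 0 := by simpa [hc] using hf0
  set p : MvPolynomial (Fin n) K := monomial v c⁻¹ * f with hp
  have hv0 : monomial v c⁻¹ ≠ 0 := by simpa using hc0
  have hpd : m.degree p = m.degree f + v := by
    rw [hp, m.degree_mul hv0 hf0, m.degree_monomial, if_neg (inv_ne_zero hc0), add_comm]
  have hplc : m.leadingCoeff p = 1 := by
    rw [hp, m.leadingCoeff_mul, m.leadingCoeff_monomial, ← hc, inv_mul_cancel₀ hc0]
  -- Passing to this component only shrinks the support and keeps the leading monomial, so the
  -- leading term survives for any monomial order.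
  set q := homogeneousComponent (m.degree f + v).degree p with hq
  have hqc : coeff (m.degree f + v) q = 1 := by
    rw [hq, coeff_homogeneousComponent, if_pos rfl, ← hpd]; exact hplc
  have hqd : m.degree q = m.degree f + v := by
    apply m.toSyn.injective
    apply le_antisymm
    · rw [← hpd]
      apply m.degree_le_degree_of_support_subset
      rw [hq, support_homogeneousComponent]
      exact Finset.filter_subset _ _
    · apply m.le_degree
      simp [mem_support_iff, hqc]
  refine ⟨q, hL _ (L.mul_mem_left _ hf) _, homogeneousComponent_isHomogeneous _ _, ?_, hqd⟩
  rw [MonomialOrder.Monic, MonomialOrder.leadingCoeff, hqd, hqc]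

end InitialMonomials

/-! ### Coordinate changes and transvections. -/

section ChangeCoords

variable {n : ℕ} {K : Type*} [Field K]

lemma changeCoords_X (g : GL (Fin n) K) (j : Fin n) :
    changeCoords g (X j) = ∑ k, C ((g : Matrix (Fin n) (Fin n) K) k j) * X k := by
  simp [changeCoords]

/-- With this order of composition, multiplying `g` on the left by a transvection means applying the
transvection to the already transformed ideal. -/
lemma changeCoords_mul (g h : GL (Fin n) K) :
    changeCoords (g * h) = (changeCoords g).comp (changeCoords h) := by
  ext1 j
  simp only [AlgHom.comp_apply, changeCoords_X, map_sum, map_mul, Units.val_mul, Matrix.mul_apply,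
    algHom_C, algebraMap_eq, Finset.sum_mul, Finset.mul_sum]
  rw [Finset.sum_comm]
  exact Finset.sum_congr rfl fun k _ => Finset.sum_congr rfl fun l _ => by ring

lemma MvPolynomial.IsHomogeneous.changeCoords {f : MvPolynomial (Fin n) K} {d : ℕ}
    (hf : f.IsHomogeneous d) (g : GL (Fin n) K) : (changeCoords g f).IsHomogeneous d := by
  have := hf.aeval (n := 1) (fun j => ∑ k, C ((g : Matrix (Fin n) (Fin n) K) k j) * X k)
    (fun j => IsHomogeneous.sum _ _ _ fun k _ => isHomogeneous_C_mul_X _ _)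
  simpa [_root_.changeCoords] using this

lemma GeneratedInDegreeLE.map_changeCoords {I : Ideal (MvPolynomial (Fin n) K)} {e : ℕ}
    (hI : GeneratedInDegreeLE I e) (g : GL (Fin n) K) :
    GeneratedInDegreeLE (I.map (changeCoords g)) e := by
  obtain ⟨S, hS, rfl⟩ := hI
  refine ⟨changeCoords g '' S, ?_, Ideal.map_span _ _⟩
  rintro _ ⟨f, hf, rfl⟩
  obtain ⟨d, hd, hfd⟩ := hS f hf
  exact ⟨d, hd, hfd.changeCoords g⟩

lemma GeneratedInDegreeLE.homogeneousComponent_mem {I : Ideal (MvPolynomial (Fin n) K)} {e : ℕ}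
    (hI : GeneratedInDegreeLE I e) (f : MvPolynomial (Fin n) K) (hf : f ∈ I) (d : ℕ) :
    homogeneousComponent d f ∈ I := by
  obtain ⟨S, hS, rfl⟩ := hI
  exact homogeneousComponent_mem_span (fun f hf => (hS f hf).imp fun _ h => h.2) hf d

/-- The elementary change of coordinates `X t ↦ X t + s • X j`. -/
def transvectionGL {j t : Fin n} (h : j ≠ t) (s : K) : GL (Fin n) K :=
  Matrix.GeneralLinearGroup.mkOfDetNeZero (Matrix.transvection j t s)
    (by rw [Matrix.det_transvection_of_ne _ _ h]; exact one_ne_zero)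

lemma coe_transvectionGL {j t : Fin n} (h : j ≠ t) (s : K) :
    (transvectionGL h s : Matrix (Fin n) (Fin n) K) = Matrix.transvection j t s := rfl

/-- The change of coordinates `X t ↦ X t + s • X j` with an indeterminate `s`. -/
noncomputable def genericTransvection (j t : Fin n) :
    MvPolynomial (Fin n) K →ₐ[K] MvPolynomial (Fin n) (Polynomial K) :=
  aeval fun k => X k + if k = t then C Polynomial.X * X j else 0

lemma map_eval_genericTransvection {j t : Fin n} (h : j ≠ t) (s : K)
    (f : MvPolynomial (Fin n) K) :
    map (Polynomial.evalRingHom s) (genericTransvection j t f) =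
      changeCoords (transvectionGL h s) f := by
  induction f using MvPolynomial.induction_on with
  | C a =>
    simp only [algHom_C]
    simp [MvPolynomial.algebraMap_apply]
  | add p q hp hq => simp [hp, hq]
  | mul_X p k hp =>
    rw [map_mul, map_mul, map_mul, hp, changeCoords_X, coe_transvectionGL]
    congr 1
    simp only [genericTransvection, aeval_X, map_add, map_X, Matrix.transvection, Matrix.add_apply,
      Matrix.one_apply, Matrix.single_apply, add_mul, Finset.sum_add_distrib]
    congr 1
    · simp
    · by_cases hk : k = t
      · subst hk; simp [apply_ite (C (R := K) (σ := Fin n)), ite_mul]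
      · simp [hk, Ne.symm hk]

lemma coeff_eval_genericTransvection {j t : Fin n} (h : j ≠ t) (s : K)
    (f : MvPolynomial (Fin n) K) (c : Fin n →₀ ℕ) :
    (coeff c (genericTransvection j t f)).eval s =
      coeff c (changeCoords (transvectionGL h s) f) := by
  rw [← map_eval_genericTransvection h, coeff_map]
  rfl

/-- First order expansion of a generic transvection. -/
lemma genericTransvection_expansion (j t : Fin n) (f : MvPolynomial (Fin n) K) :
    ∃ r, genericTransvection j t f = map Polynomial.C f +
      C Polynomial.X * map Polynomial.C (X j * pderiv t f) + C (Polynomial.X ^ 2) * r := by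
  induction f using MvPolynomial.induction_on with
  | C a => exact ⟨0, by simp [algHom_C, MvPolynomial.algebraMap_apply]⟩
  | add p q hp hq =>
    obtain ⟨r, hr⟩ := hp
    obtain ⟨r', hr'⟩ := hq
    refine ⟨r + r', ?_⟩
    simp only [map_add, hr, hr', mul_add]
    ring
  | mul_X p k hp =>
    obtain ⟨r, hr⟩ := hp
    by_cases hk : k = t
    · subst hk
      refine ⟨r * X k + map Polynomial.C (X j * pderiv k p) * X j + C Polynomial.X * r * X j, ?_⟩
      rw [map_mul, hr]
      simp only [genericTransvection, aeval_X, if_true, pderiv_mul, pderiv_X_self, map_mul, map_add,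
        map_X, map_one, map_pow]
      ring
    · refine ⟨r * X k, ?_⟩
      rw [map_mul, hr]
      simp only [genericTransvection, aeval_X, if_neg hk, pderiv_mul, pderiv_X_of_ne hk, map_mul,
        map_add, map_X, map_zero, map_pow]
      ring

lemma coeff_zero_coeff_genericTransvection (j t : Fin n) (f : MvPolynomial (Fin n) K)
    (c : Fin n →₀ ℕ) : (coeff c (genericTransvection j t f)).coeff 0 = coeff c f := by
  obtain ⟨r, hr⟩ := genericTransvection_expansion j t f
  rw [hr, coeff_add, coeff_add, coeff_C_mul, coeff_C_mul, coeff_map, coeff_map]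
  simp

lemma coeff_one_coeff_genericTransvection (j t : Fin n) (f : MvPolynomial (Fin n) K)
    (c : Fin n →₀ ℕ) :
    (coeff c (genericTransvection j t f)).coeff 1 = coeff c (X j * pderiv t f) := by
  obtain ⟨r, hr⟩ := genericTransvection_expansion j t f
  rw [hr, coeff_add, coeff_add, coeff_C_mul, coeff_C_mul, coeff_map, coeff_map]
  simp [Polynomial.coeff_X_pow_mul', Polynomial.coeff_C]

/-- A nonempty Zariski-open set contains almost all points of a line of transvections through any
of its points. -/
lemma IsZariskiOpenGL.exists_polynomial_transvection {U : Set (GL (Fin n) K)}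
    (hU : IsZariskiOpenGL U) {g : GL (Fin n) K} (hg : g ∈ U) {j t : Fin n} (h : j ≠ t) :
    ∃ q : Polynomial K, q ≠ 0 ∧ ∀ s, q.eval s ≠ 0 → transvectionGL h s * g ∈ U := by
  obtain ⟨S, rfl⟩ := hU
  obtain ⟨p, hp, hpg⟩ := hg
  -- The entries of the product, as polynomials in `s`: row `j` of `g` gains `s` times row `t`.
  let φ : Fin n × Fin n → Polynomial K := fun e =>
    Polynomial.C ((g : Matrix (Fin n) (Fin n) K) e.1 e.2) +
      if e.1 = j then Polynomial.X * Polynomial.C ((g : Matrix (Fin n) (Fin n) K) t e.2) else 0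
  have key : ∀ s, (aeval φ p).eval s =
      eval (fun e => ((transvectionGL h s * g : GL (Fin n) K) : Matrix (Fin n) (Fin n) K) e.1 e.2)
        p := by
    intro s
    have h1 := comp_aeval_apply (f := φ) (Polynomial.aeval s) p
    rw [Polynomial.coe_aeval_eq_eval] at h1
    rw [h1, ← coe_aeval_eq_eval]
    change aeval _ p = aeval _ p
    congr 2
    funext e
    rw [Units.val_mul, coe_transvectionGL, Matrix.transvection, Matrix.add_mul, Matrix.one_mul,
      Matrix.add_apply]
    by_cases he : e.1 = j
    · simp only [φ, he, if_true, Polynomial.eval_add, Polynomial.eval_C, Polynomial.eval_mul,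
        Polynomial.eval_X, Matrix.single_mul_apply_same]
    · simp [φ, he]
  refine ⟨aeval φ p, fun h0 => hpg ?_, fun s hs => ⟨p, hp, ?_⟩⟩
  · have := key 0
    rw [h0, Units.val_mul, coe_transvectionGL, Matrix.transvection_zero, one_mul] at this
    simpa using this.symm
  · rw [key] at hs
    exact hs

end ChangeCoords

/-! ### Strong stability of generic initial ideals. -/

section StronglyStable

variable {n : ℕ} {K : Type*} [Field K] {m : MonomialOrder (Fin n)}

/-- The operator `X j * pderiv t` replaces one factor `X t` by `X j`, which preserves strict
comparisons of monomials. -/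
lemma coeff_X_mul_pderiv_of_degree_le {f : MvPolynomial (Fin n) K} {j t : Fin n}
    {b v : Fin n →₀ ℕ} (hf : m.degree f ≼[m] b + Finsupp.single t 1)
    (hv : b + Finsupp.single j 1 ≺[m] v) : coeff v (X j * pderiv t f) = 0 := by
  rw [coeff_X_mul']
  split_ifs with hj
  · have hv' : v - Finsupp.single j 1 + Finsupp.single j 1 = v :=
      tsub_add_cancel_of_le (by
        rw [Finsupp.single_le_iff]
        exact Nat.one_le_iff_ne_zero.2 (Finsupp.mem_support_iff.1 hj))
    rw [coeff_pderiv, m.coeff_eq_zero_of_lt, zero_mul]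
    refine lt_of_le_of_lt hf ?_
    rw [← hv', map_add, map_add, add_lt_add_iff_right] at hv
    rw [map_add, map_add]
    exact add_lt_add_left hv _
  · rfl

/-- The factor `b t + 1` must not vanish in `K`; this is where characteristic zero matters. -/
lemma coeff_X_mul_pderiv_add_single (f : MvPolynomial (Fin n) K) (j t : Fin n) (b : Fin n →₀ ℕ) :
    coeff (b + Finsupp.single j 1) (X j * pderiv t f) =
      coeff (b + Finsupp.single t 1) f * (b t + 1) := by
  rw [add_comm b (Finsupp.single j 1), coeff_X_mul, coeff_pderiv]

/-- Generic initial ideals are strongly stable in characteristic zero. -/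
theorem IsGin.monomial_add_single_mem [CharZero K] {I J : Ideal (MvPolynomial (Fin n) K)} {e : ℕ}
    (hI : GeneratedInDegreeLE I e) (hJ : IsGin m I J) {j t : Fin n}
    (hjt : Finsupp.single t 1 ≺[m] Finsupp.single j 1) {b : Fin n →₀ ℕ}
    (hb : monomial (b + Finsupp.single t 1) (1 : K) ∈ J) :
    monomial (b + Finsupp.single j 1) (1 : K) ∈ J := by
  classical
  by_contra hn
  have hne : j ≠ t := by rintro rfl; exact lt_irrefl _ hjt
  obtain ⟨U, hU, ⟨g, hg⟩, hUJ⟩ := hJ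
  obtain ⟨q, hq0, hq⟩ := hU.exists_polynomial_transvection hg hne
  have hL := hI.map_changeCoords g
  have hex : ∀ u, monomial u (1 : K) ∈ J → ∃ f ∈ I.map (changeCoords g),
      f.IsHomogeneous u.degree ∧ m.Monic f ∧ m.degree f = u := by
    intro u hu
    rw [← hUJ g hg] at hu
    exact exists_monic_form_of_mem_initialIdeal hL.homogeneousComponent_mem hu
  choose! F hFL hFh hFm hFd using hex
  set a := b + Finsupp.single t 1 with ha
  set a' := b + Finsupp.single j 1 with ha'
  have haa' : a ≺[m] a' := by
    rw [ha, ha', map_add, map_add]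
    exact add_lt_add_right hjt _
  -- The plan is to produce, for another point of `U`, a form whose coefficients on `T` vanish
  -- except at `a'`. Its leading monomial lies in `J`, hence in `T`, so it must be `a'`.
  let T : Set (Fin n →₀ ℕ) := 
    {c | (c = a' ∨ monomial c (1 : K) ∈ J) ∧ c.degree = a.degree ∧ a' ≼[m] c}
  have hT : T.Finite := (Finsupp.finite_of_degree_eq a.degree).subset fun c hc => hc.2.1
  have : Fintype T := hT.fintype
  let _ : LinearOrder T := LinearOrder.lift' (fun c => m.toSyn c.1)
    (m.toSyn.injective.comp Subtype.val_injective)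
  have haT : a' ∈ T := ⟨Or.inl rfl, by simp [ha, ha'], le_rfl⟩
  -- Row `a'` comes from `F a`. All exponents in `T` exceed `a`, so those coefficients vanish at `s
  -- = 0` and `divX` divides exactly by `s`.
  let M : Matrix T T (Polynomial K) := Matrix.of fun c v =>
    if c.1 = a' then (coeff v.1 (genericTransvection j t (F a))).divX
    else coeff v.1 (genericTransvection j t (F c.1))
  have hMdet : ∀ s, (M.map (Polynomial.evalRingHom s)).det = M.det.eval s := fun s =>
    (RingHom.map_det (Polynomial.evalRingHom s) M).symm
  -- At `s = 0` the rows are the coefficients of `F c` and, in row `a'`, of the derivative `X j *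
  -- pderiv t (F a)`. Their leading monomials index the diagonal, with entries `1` and `b t + 1`.
  have hM0 : (M.map (Polynomial.evalRingHom 0)).det ≠ 0 := by
    rw [Matrix.det_of_isLowerTriangular]
    · refine Finset.prod_ne_zero_iff.2 fun c _ => ?_
      by_cases hc : c.1 = a'
      · have h1 : coeff a (F a) = 1 := by
          have := (hFm a hb).coeff_degree
          rwa [hFd a hb] at this
        simp only [M, Matrix.map_apply, Matrix.of_apply, hc, if_true,
          Polynomial.coe_evalRingHom, ← Polynomial.coeff_zero_eq_eval_zero, Polynomial.coeff_divX,
          zero_add, coeff_one_coeff_genericTransvection, ha', coeff_X_mul_pderiv_add_single]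
        rw [← ha, h1, one_mul]
        exact Nat.cast_add_one_ne_zero _
      · have hcJ := c.2.1.resolve_left hc
        have h1 := (hFm c.1 hcJ).coeff_degree
        rw [hFd c.1 hcJ] at h1
        simp [M, hc, ← Polynomial.coeff_zero_eq_eval_zero, coeff_zero_coeff_genericTransvection, h1]
    · intro c v hcv
      replace hcv : c.1 ≺[m] v.1 := hcv
      by_cases hc : c.1 = a'
      · simp only [M, Matrix.map_apply, Matrix.of_apply, hc, if_true,
          Polynomial.coe_evalRingHom, ← Polynomial.coeff_zero_eq_eval_zero, Polynomial.coeff_divX,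
          zero_add, coeff_one_coeff_genericTransvection]
        refine coeff_X_mul_pderiv_of_degree_le (m := m) (b := b) (by rw [hFd a hb]) ?_
        rwa [hc] at hcv
      · have hcJ := c.2.1.resolve_left hc
        simp only [M, Matrix.map_apply, Matrix.of_apply, hc, if_false,
          Polynomial.coe_evalRingHom, ← Polynomial.coeff_zero_eq_eval_zero,
          coeff_zero_coeff_genericTransvection]
        exact m.coeff_eq_zero_of_lt (by rwa [hFd c.1 hcJ])
  have hdet : M.det ≠ 0 := by
    intro h0
    rw [hMdet, h0, Polynomial.eval_zero] at hM0
    exact hM0 rfl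
  -- The three factors secure a point of `U`, an invertible matrix, and `s ≠ 0` for the division by
  -- `s`.
  obtain ⟨s, hs⟩ : ∃ s, (q * M.det * Polynomial.X).eval s ≠ 0 := by
    by_contra! h
    exact mul_ne_zero (mul_ne_zero hq0 hdet) Polynomial.X_ne_zero
      (Polynomial.funext (by simpa using h))
  simp only [Polynomial.eval_mul, Polynomial.eval_X, mul_ne_zero_iff] at hs
  obtain ⟨⟨hqs, hMs⟩, hs0⟩ := hs
  set N := M.map (Polynomial.evalRingHom s) with hN
  have hNu : IsUnit N.det := by
    rw [isUnit_iff_ne_zero, hN, hMdet]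
    exact hMs
  -- These weights combine the rows of `N` into the unit vector at `a'`.
  let w : T → K := Matrix.vecMul (Pi.single ⟨a', haT⟩ 1) N⁻¹
  have hw : Matrix.vecMul w N = Pi.single ⟨a', haT⟩ 1 := by
    rw [Matrix.vecMul_vecMul, Matrix.nonsing_inv_mul _ hNu, Matrix.vecMul_one]
  let γ := transvectionGL hne s
  let G : T → MvPolynomial (Fin n) K := fun c =>
    if c.1 = a' then C s⁻¹ * changeCoords γ (F a) else changeCoords γ (F c.1)
  have hG : ∀ c v : T, coeff v.1 (G c) = N c v := by
    intro c v
    by_cases hc : c.1 = a'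
    · have h0 : (coeff v.1 (genericTransvection j t (F a))).coeff 0 = 0 := by
        rw [coeff_zero_coeff_genericTransvection]
        exact m.coeff_eq_zero_of_lt (by rw [hFd a hb]; exact lt_of_lt_of_le haa' v.2.2.2)
      have h1 := Polynomial.divX_mul_X_add (coeff v.1 (genericTransvection j t (F a)))
      rw [h0, map_zero, add_zero] at h1
      simp only [G, hc, if_true, hN, M, Matrix.map_apply, Matrix.of_apply, coeff_C_mul,
        Polynomial.coe_evalRingHom, γ]
      rw [← coeff_eval_genericTransvection, ← h1, Polynomial.eval_mul, Polynomial.eval_X, h1]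
      field_simp
    · simp only [G, hc, if_false, hN, M, Matrix.map_apply, Matrix.of_apply,
        Polynomial.coe_evalRingHom, γ]
      rw [← coeff_eval_genericTransvection]
  have hmap : I.map (changeCoords (γ * g)) = (I.map (changeCoords g)).map (changeCoords γ) := by
    rw [changeCoords_mul, Ideal.map_mapₐ]
  have hGL : ∀ c, G c ∈ I.map (changeCoords (γ * g)) := by
    intro c
    rw [hmap]
    by_cases hc : c.1 = a'
    · simp only [G, hc, if_true]
      exact Ideal.mul_mem_left _ _ (Ideal.mem_map_of_mem _ (hFL a hb))
    · simp only [G, hc, if_false]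
      exact Ideal.mem_map_of_mem _ (hFL _ (c.2.1.resolve_left hc))
  have hGh : ∀ c, (G c).IsHomogeneous a.degree := by
    intro c
    by_cases hc : c.1 = a'
    · simp only [G, hc, if_true]
      exact ((hFh a hb).changeCoords γ).C_mul _
    · simp only [G, hc, if_false]
      rw [← c.2.2.1]
      exact (hFh _ (c.2.1.resolve_left hc)).changeCoords γ
  let f := ∑ c, C (w c) * G c
  have hfc : ∀ v : T, coeff v.1 f = if v.1 = a' then 1 else 0 := by
    intro v
    have h1 := congrFun hw v
    rw [Matrix.vecMul, dotProduct] at h1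
    simp only [f, coeff_sum, coeff_C_mul, hG, h1, Pi.single_apply, Subtype.ext_iff]
  have hfL : f ∈ I.map (changeCoords (γ * g)) :=
    Ideal.sum_mem _ fun c _ => Ideal.mul_mem_left _ _ (hGL c)
  have hfh : f.IsHomogeneous a.degree := IsHomogeneous.sum _ _ _ fun c _ => (hGh c).C_mul _
  have hfa : coeff a' f = 1 := by simpa using hfc ⟨a', haT⟩
  have hf0 : f ≠ 0 := by
    intro h0
    simp [h0] at hfa
  have hdJ : monomial (m.degree f) (1 : K) ∈ J := by
    rw [← hUJ _ (hq s hqs)]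
    exact monomial_degree_mem_initialIdeal hfL hf0
  have hdT : m.degree f ∈ T := by
    refine ⟨Or.inr hdJ, ?_, m.le_degree (by simp [mem_support_iff, hfa])⟩
    by_contra h
    exact m.coeff_degree_ne_zero_iff.2 hf0 (hfh.coeff_eq_zero h)
  have h2 := hfc ⟨_, hdT⟩
  split_ifs at h2 with h3
  · exact hn (h3 ▸ hdJ)
  · exact m.coeff_degree_ne_zero_iff.2 hf0 h2

end StronglyStable

/-! ### Low monomials and the ideal of the high variables. -/

section Crystallization

variable {n : ℕ} {K : Type*} [Field K]

/-- The monomial with exponent `u` only involves the first `i` variables. -/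
def IsLow (i : ℕ) (u : Fin n →₀ ℕ) : Prop := ∀ j ∈ u.support, (j : ℕ) < i

lemma IsLow.mono {i : ℕ} {u v : Fin n →₀ ℕ} (hv : IsLow i v) (h : u ≤ v) : IsLow i u := by
  intro j hj
  refine hv j ?_
  have := h j
  simp only [Finsupp.mem_support_iff] at hj ⊢
  omega

lemma IsLow.add_single {i : ℕ} {u : Fin n →₀ ℕ} (hu : IsLow i u) {t : Fin n} (ht : (t : ℕ) < i) :
    IsLow i (u + Finsupp.single t 1) := by
  intro j hj
  rcases eq_or_ne j t with rfl | hjt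
  · exact ht
  · refine hu j ?_
    simpa [Finsupp.single_apply, hjt.symm] using hj

/-- The ideal generated by the variables with index at least `i`. -/
noncomputable def highIdeal (n : ℕ) (K : Type*) [Field K] (i : ℕ) :
    Ideal (MvPolynomial (Fin n) K) :=
  Ideal.span (X '' {k : Fin n | i ≤ (k : ℕ)})

lemma mem_highIdeal_iff {i : ℕ} {f : MvPolynomial (Fin n) K} :
    f ∈ highIdeal n K i ↔ ∀ u ∈ f.support, ¬ IsLow i u := by
  rw [highIdeal, mem_ideal_span_X_image]
  refine forall₂_congr fun u _ => ?_
  simp [IsLow, and_comm]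

/-- A form whose reverse lexicographic leading monomial involves a high variable lies in the ideal
of the high variables. -/
lemma mem_highIdeal_of_degree {i d : ℕ} {f : MvPolynomial (Fin n) K} (hf : f.IsHomogeneous d)
    (h : ¬ IsLow i ((degRevLex n).degree f)) : f ∈ highIdeal n K i := by
  rw [mem_highIdeal_iff]
  intro v hv
  rcases eq_or_ne v ((degRevLex n).degree f) with rfl | hne
  · exact h
  have hf0 : f ≠ 0 := by rintro rfl; simp at hv
  have hlt : v ≺[degRevLex n] (degRevLex n).degree f :=
    lt_of_le_of_ne ((degRevLex n).le_degree hv) ((degRevLex n).toSyn.injective.ne hne)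
  have hdeg : v.degree = ((degRevLex n).degree f).degree :=
    (hf.degree_eq_sum_deg_support hv).symm.trans
      (hf.degree_eq_sum_deg_support ((degRevLex n).degree_mem_support hf0))
  rcases degRevLex_lt_iff.1 hlt with h1 | ⟨-, j, h1, h2⟩
  · omega
  simp only [IsLow, not_forall, not_lt] at h ⊢
  obtain ⟨k, hk, hik⟩ := h
  -- If `v` differs last before `k`, it shares the high variable `k`; otherwise degrevlex gives `v`
  -- a larger exponent at `j`, itself high.
  rcases lt_or_ge j k with hjk | hkj
  · exact ⟨k, by simpa [h1 k hjk] using hk, hik⟩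
  · refine ⟨j, ?_, hik.trans hkj⟩
    rw [Finsupp.mem_support_iff]
    omega

/-! ### Strong stability and low multiples. -/

/-- Replacing a variable by an earlier one keeps a monomial in `J`. -/
def StronglyStable (J : Ideal (MvPolynomial (Fin n) K)) : Prop :=
  ∀ ⦃j t : Fin n⦄, j < t → ∀ b : Fin n →₀ ℕ,
    monomial (b + Finsupp.single t 1) (1 : K) ∈ J → monomial (b + Finsupp.single j 1) (1 : K) ∈ J

/-- The exponents of the monomials in the first `i` variables that have a divisor of degree `δ`
in `J`. -/
def lowMultiples (J : Ideal (MvPolynomial (Fin n) K)) (δ i : ℕ) : Set (Fin n →₀ ℕ) :=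
  {u | IsLow i u ∧ ∃ a ≤ u, a.degree = δ ∧ monomial a (1 : K) ∈ J}

variable {J L : Ideal (MvPolynomial (Fin n) K)} {δ i : ℕ}

lemma add_single_mem_lowMultiples {u : Fin n →₀ ℕ} (hu : u ∈ lowMultiples J δ i) {t : Fin n}
    (ht : (t : ℕ) < i) : u + Finsupp.single t 1 ∈ lowMultiples J δ i := by
  obtain ⟨hlow, a, hau, ha⟩ := hu
  exact ⟨hlow.add_single ht, a, hau.trans le_self_add, ha⟩

lemma degree_le_of_mem_lowMultiples {u : Fin n →₀ ℕ} (hu : u ∈ lowMultiples J δ i) :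
    δ ≤ u.degree := by
  obtain ⟨-, a, hau, rfl, -⟩ := hu
  exact Finsupp.degree_mono hau

lemma monomial_mem_of_mem_lowMultiples {u : Fin n →₀ ℕ} (hu : u ∈ lowMultiples J δ i) :
    monomial u (1 : K) ∈ J := by
  obtain ⟨-, a, hau, -, ha⟩ := hu
  obtain ⟨c, rfl⟩ := exists_add_of_le hau
  have := J.mul_mem_left (monomial c 1) ha
  rwa [monomial_mul, one_mul, add_comm] at this

/-- Dividing by the last variable stays within the multiples of the monomials of degree `δ` of a
strongly stable ideal. -/
lemma StronglyStable.mem_lowMultiples_of_add_single (hJ : StronglyStable J) {u : Fin n →₀ ℕ}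
    {t : Fin n} (ht : ∀ l ∈ u.support, l ≤ t) (hδ : δ ≤ u.degree)
    (hu : u + Finsupp.single t 1 ∈ lowMultiples J δ i) : u ∈ lowMultiples J δ i := by
  obtain ⟨hlow, a, hau, had, haJ⟩ := hu
  refine ⟨hlow.mono le_self_add, ?_⟩
  by_cases hle : a ≤ u
  · exact ⟨a, hle, had, haJ⟩
  have hne : ∀ l, l ≠ t → a l ≤ u l := by
    intro l hl
    simpa [Finsupp.single_apply, hl.symm] using hau l
  have hat : a t = u t + 1 := by
    have h1 : a t ≤ u t + 1 := by simpa using hau t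
    have h2 : ¬ a t ≤ u t := by
      intro h2
      refine hle fun l => ?_
      rcases eq_or_ne l t with rfl | hl
      · exact h2
      · exact hne l hl
    omega
  -- The divisor `a` uses one `t` too many, but its degree `δ` is at most that of `u`, so there is
  -- room at some other `j`. Trading that `t` for `j` gives a divisor of `u` still in `J`.
  obtain ⟨j, hj⟩ : ∃ j, a j < u j := by
    by_contra! h
    have h1 : u + Finsupp.single t 1 ≤ a := by
      intro l
      rcases eq_or_ne l t with rfl | hl
      · simp [hat]
      · simpa [Finsupp.single_apply, hl.symm] using h l
    have h2 := Finsupp.degree_mono h1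
    simp only [map_add, Finsupp.degree_single] at h2
    omega
  have hjt : j ≠ t := by rintro rfl; omega
  have hlt : j < t := lt_of_le_of_ne (ht j (by rw [Finsupp.mem_support_iff]; omega)) hjt
  have hb : Finsupp.single t 1 ≤ a := by
    rw [Finsupp.single_le_iff]; omega
  obtain ⟨b, rfl⟩ := exists_add_of_le hb
  rw [add_comm] at haJ
  refine ⟨b + Finsupp.single j 1, fun l => ?_, ?_, hJ hlt b haJ⟩
  · rcases eq_or_ne l t with rfl | hlt'
    · simp only [Finsupp.add_apply, Finsupp.single_eq_same] at hat
      simp only [Finsupp.add_apply, Finsupp.single_apply, hjt, if_false]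
      omega
    · have h1 := hne l hlt'
      simp only [Finsupp.add_apply, Finsupp.single_apply, hlt'.symm, if_false] at h1 ⊢
      rcases eq_or_ne j l with rfl | hjl
      · simp only [Finsupp.add_apply, Finsupp.single_apply, hjt.symm, if_false, if_true] at hj ⊢
        omega
      · simpa [hjl] using h1
  · simp only [map_add, Finsupp.degree_single] at had ⊢
    omega

lemma exists_eq_add_single_of_ne_zero {u : Fin n →₀ ℕ} (hu : u ≠ 0) :
    ∃ (v : Fin n →₀ ℕ) (t : Fin n), u = v + Finsupp.single t 1 ∧ ∀ l ∈ v.support, l ≤ t := by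
  have hne : u.support.Nonempty := Finsupp.support_nonempty_iff.2 hu
  have ht := u.support.max'_mem hne
  refine ⟨u - Finsupp.single (u.support.max' hne) 1, u.support.max' hne, ?_, fun l hl => ?_⟩
  · rw [tsub_add_cancel_of_le]
    rw [Finsupp.single_le_iff]
    exact Nat.one_le_iff_ne_zero.2 (Finsupp.mem_support_iff.1 ht)
  · refine Finset.le_max' _ _ ?_
    simp only [Finsupp.mem_support_iff, Finsupp.tsub_apply] at hl ⊢
    omega

/-! ### Construction of the involutive family. -/

/-- Extend a family of polynomials by multiplication with the last variables of the exponents,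
`e` times. -/
noncomputable def multiplicativeExtension (F : (Fin n →₀ ℕ) → MvPolynomial (Fin n) K) :
    ℕ → (Fin n →₀ ℕ) → MvPolynomial (Fin n) K
  | 0, u => F u
  | e + 1, u => if hu : u.support.Nonempty then
      X (u.support.max' hu) *
        multiplicativeExtension F e (u - Finsupp.single (u.support.max' hu) 1) else 0

lemma multiplicativeExtension_add_single (F : (Fin n →₀ ℕ) → MvPolynomial (Fin n) K) (e : ℕ)
    {u : Fin n →₀ ℕ} {t : Fin n} (ht : ∀ l ∈ u.support, l ≤ t) :
    multiplicativeExtension F (e + 1) (u + Finsupp.single t 1) =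
      X t * multiplicativeExtension F e u := by
  have hmem : t ∈ (u + Finsupp.single t 1).support := by simp
  have hmax : (u + Finsupp.single t 1).support.max' ⟨t, hmem⟩ = t := by
    refine le_antisymm (Finset.max'_le _ _ _ fun l hl => ?_) (Finset.le_max' _ _ hmem)
    by_contra h
    have hlt : l ≠ t := by rintro rfl; exact h le_rfl
    exact h (ht l (by simpa [Finsupp.single_apply, hlt.symm] using hl))
  rw [multiplicativeExtension, dif_pos ⟨t, hmem⟩, hmax, add_tsub_cancel_right]

/-- A family of monic forms in `L` with prescribed leading monomials, compatible with
multiplication by variables beyond all those of the leading monomial. -/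
structure IsInvolutiveFamily (L J : Ideal (MvPolynomial (Fin n) K)) (δ i : ℕ)
    (h : (Fin n →₀ ℕ) → MvPolynomial (Fin n) K) : Prop where
  mem : ∀ u ∈ lowMultiples J δ i, h u ∈ L
  isHomogeneous : ∀ u ∈ lowMultiples J δ i, (h u).IsHomogeneous u.degree
  monic : ∀ u ∈ lowMultiples J δ i, (degRevLex n).Monic (h u)
  degree_eq : ∀ u ∈ lowMultiples J δ i, (degRevLex n).degree (h u) = u
  add_single : ∀ (u : Fin n →₀ ℕ) (t : Fin n), δ ≤ u.degree → (∀ l ∈ u.support, l ≤ t) →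
    h (u + Finsupp.single t 1) = X t * h u

lemma StronglyStable.exists_isInvolutiveFamily (hJ : StronglyStable J)
    (hex : ∀ u, monomial u (1 : K) ∈ J →
      ∃ f ∈ L, f.IsHomogeneous u.degree ∧ (degRevLex n).Monic f ∧ (degRevLex n).degree f = u) :
    ∃ h, IsInvolutiveFamily L J δ i h := by
  classical
  choose! F hFL hFh hFm hFd using hex
  have key : ∀ e u, u ∈ lowMultiples J δ i → u.degree = δ + e →
      multiplicativeExtension F e u ∈ L ∧
      (multiplicativeExtension F e u).IsHomogeneous u.degree ∧
      (degRevLex n).Monic (multiplicativeExtension F e u) ∧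
      (degRevLex n).degree (multiplicativeExtension F e u) = u := by
    intro e
    induction e with
    | zero =>
      intro u hu _
      have huJ := monomial_mem_of_mem_lowMultiples hu
      exact ⟨hFL u huJ, hFh u huJ, hFm u huJ, hFd u huJ⟩
    | succ e ih =>
      intro u hu hd
      have hu0 : u ≠ 0 := by rintro rfl; simp at hd
      obtain ⟨v, t, rfl, ht⟩ := exists_eq_add_single_of_ne_zero hu0
      simp only [map_add, Finsupp.degree_single] at hd
      obtain ⟨h1, h2, h3, h4⟩ :=
        ih v (hJ.mem_lowMultiples_of_add_single ht (by omega) hu) (by omega)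
      rw [multiplicativeExtension_add_single F e ht]
      refine ⟨L.mul_mem_left _ h1, ?_, ?_, ?_⟩
      · rw [map_add, Finsupp.degree_single, add_comm]
        exact (isHomogeneous_X K t).mul h2
      · exact MonomialOrder.Monic.mul MonomialOrder.monic_X h3
      · rw [MonomialOrder.degree_mul (X_ne_zero t) h3.ne_zero, MonomialOrder.degree_X, h4,
          add_comm]
  have key' := fun u hu => key (u.degree - δ) u hu
    (by have := degree_le_of_mem_lowMultiples hu; omega)
  -- Exactly `u.degree - δ` last variables are stripped, ending in degree `δ`; the subtraction is
  -- not truncated on `lowMultiples`.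
  refine ⟨fun u => multiplicativeExtension F (u.degree - δ) u, fun u hu => (key' u hu).1,
    fun u hu => (key' u hu).2.1, fun u hu => (key' u hu).2.2.1, fun u hu => (key' u hu).2.2.2,
    fun u t hu ht => ?_⟩
  rw [← multiplicativeExtension_add_single F _ ht, map_add, Finsupp.degree_single]
  congr 1
  omega

/-! ### Reduction by the family modulo the high variables. -/

namespace IsInvolutiveFamily

variable {h : (Fin n →₀ ℕ) → MvPolynomial (Fin n) K}

/-- The span of the members of a family with exponent in `D`, plus the ideal of the high
variables. -/
noncomputable def spanOn (h : (Fin n →₀ ℕ) → MvPolynomial (Fin n) K) (i : ℕ)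
    (D : Set (Fin n →₀ ℕ)) : Submodule K (MvPolynomial (Fin n) K) :=
  Submodule.span K (h '' D) ⊔ (highIdeal n K i).restrictScalars K

lemma spanOn_mono {D D' : Set (Fin n →₀ ℕ)} (hD : D ⊆ D') : spanOn h i D ≤ spanOn h i D' :=
  sup_le_sup_right (Submodule.span_mono (Set.image_mono hD)) _

lemma mem_spanOn {D : Set (Fin n →₀ ℕ)} {u : Fin n →₀ ℕ} (hu : u ∈ D) : h u ∈ spanOn h i D :=
  Submodule.mem_sup_left (Submodule.subset_span ⟨u, hu, rfl⟩)

lemma mem_spanOn_of_mem_highIdeal {D : Set (Fin n →₀ ℕ)} {f : MvPolynomial (Fin n) K}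
    (hf : f ∈ highIdeal n K i) : f ∈ spanOn h i D :=
  Submodule.mem_sup_right hf

/-- The high summand is an ideal, so only the family members need checking. -/
lemma X_mul_mem_spanOn {D D' : Set (Fin n →₀ ℕ)} {t : Fin n}
    (hD : ∀ w ∈ D, X t * h w ∈ spanOn h i D') {f : MvPolynomial (Fin n) K}
    (hf : f ∈ spanOn h i D) : X t * f ∈ spanOn h i D' := by
  have hle : spanOn h i D ≤ (spanOn h i D').comap (LinearMap.mulLeft K (X t)) := by
    refine sup_le (Submodule.span_le.2 ?_) fun r hr => ?_
    · rintro _ ⟨w, hw, rfl⟩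
      exact hD w hw
    · exact mem_spanOn_of_mem_highIdeal (Ideal.mul_mem_left _ _ hr)
  exact hle hf

/-- The exponents of `lowMultiples` up to `c`. -/
def lowMultiplesLE (J : Ideal (MvPolynomial (Fin n) K)) (δ i : ℕ) (c : Fin n →₀ ℕ) :
    Set (Fin n →₀ ℕ) :=
  {u | u ∈ lowMultiples J δ i ∧ u ≼[degRevLex n] c}

lemma lowMultiplesLE_mono {c c' : Fin n →₀ ℕ} (hc : c ≼[degRevLex n] c') :
    lowMultiplesLE J δ i c ⊆ lowMultiplesLE J δ i c' :=
  fun _ hu => ⟨hu.1, hu.2.trans hc⟩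

/-- If all low leading monomials of forms of degree `d` are among the leading monomials of the
family, then these forms are reduced to zero by the family. -/
lemma mem_spanOn_of_isHomogeneous (hh : IsInvolutiveFamily L J δ i h) {d : ℕ}
    (hL : ∀ f ∈ L, f ≠ 0 → f.IsHomogeneous d → IsLow i ((degRevLex n).degree f) →
      (degRevLex n).degree f ∈ lowMultiples J δ i)
    {f : MvPolynomial (Fin n) K} (hf : f ∈ L) (hfd : f.IsHomogeneous d) :
    f ∈ spanOn h i (lowMultiplesLE J δ i ((degRevLex n).degree f)) := by
  set m := degRevLex n with hm
  obtain ⟨c, hc⟩ : ∃ c, c = m.toSyn (m.degree f) := ⟨_, rfl⟩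
  induction c using WellFoundedLT.induction generalizing f with
  | ind c ih =>
  rcases eq_or_ne f 0 with rfl | hf0
  · exact zero_mem _
  by_cases hlow : IsLow i (m.degree f)
  swap
  · exact mem_spanOn_of_mem_highIdeal (mem_highIdeal_of_degree hfd hlow)
  have hu := hL f hf hf0 hfd hlow
  set u := m.degree f with hu_def
  have hud : u.degree = d :=
    (hfd.degree_eq_sum_deg_support (m.degree_mem_support hf0)).symm
  have hsm : coeff u f • h u ∈ spanOn h i (lowMultiplesLE J δ i u) :=
    Submodule.smul_mem _ _ (mem_spanOn ⟨hu, le_rfl⟩)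
  set f' := f - coeff u f • h u with hf'
  have hff' : f = f' + coeff u f • h u := by rw [hf', sub_add_cancel]
  rcases eq_or_ne f' 0 with h0 | h0
  · rw [hff', h0, zero_add]; exact hsm
  have hcoeff : coeff u f' = 0 := by
    have h1 := (hh.monic u hu).coeff_degree
    rw [hh.degree_eq u hu] at h1
    simp [hf', h1]
  have hle : m.degree f' ≼[m] u := by
    refine m.degree_sub_le.trans (sup_le le_rfl (m.degree_smul_le.trans ?_))
    rw [hm, hh.degree_eq u hu]
  have hlt : m.degree f' ≺[m] u := by
    refine lt_of_le_of_ne hle fun heq => ?_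
    have h1 := m.coeff_degree_ne_zero_iff.2 h0
    rw [m.toSyn.injective heq] at h1
    exact h1 hcoeff
  have hf'L : f' ∈ L := by
    refine L.sub_mem hf ?_
    rw [smul_eq_C_mul]
    exact L.mul_mem_left _ (hh.mem u hu)
  have hf'd : f'.IsHomogeneous d := by
    refine hfd.sub ?_
    rw [smul_eq_C_mul, ← hud]
    exact (hh.isHomogeneous u hu).C_mul _
  rw [hff']
  refine add_mem (spanOn_mono (lowMultiplesLE_mono hle) (ih _ (hc ▸ hlt) hf'L hf'd rfl)) hsm

/-- Multiples of the family by variables are reduced to zero by the family, provided that this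
holds for the members of degree `δ`. -/
lemma X_mul_mem (hh : IsInvolutiveFamily L J δ i h) (hJ : StronglyStable J)
    (hL : ∀ f ∈ L, f ≠ 0 → f.IsHomogeneous (δ + 1) → IsLow i ((degRevLex n).degree f) →
      (degRevLex n).degree f ∈ lowMultiples J δ i) {u : Fin n →₀ ℕ} (hu : u ∈ lowMultiples J δ i)
    {k : Fin n} (hk : (k : ℕ) < i) :
    X k * h u ∈ spanOn h i (lowMultiplesLE J δ i (u + Finsupp.single k 1)) := by
  set m := degRevLex n with hm
  obtain ⟨c, hc⟩ : ∃ c, c = m.toSyn (u + Finsupp.single k 1) := ⟨_, rfl⟩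
  induction c using WellFoundedLT.induction generalizing u k with
  | ind c ih =>
  by_cases hmax : ∀ l ∈ u.support, l ≤ k
  · rw [← hh.add_single u k (degree_le_of_mem_lowMultiples hu) hmax]
    exact mem_spanOn ⟨add_single_mem_lowMultiples hu hk, le_rfl⟩
  -- In degree `δ` the product has degree `δ + 1`, where `hL` makes it reduce to zero.
  rcases (degree_le_of_mem_lowMultiples hu).eq_or_lt with hδ | hδ
  · have hd : m.degree (X k * h u) = u + Finsupp.single k 1 := by
      rw [hm, MonomialOrder.degree_mul (X_ne_zero k) (hh.monic u hu).ne_zero,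
        MonomialOrder.degree_X, hh.degree_eq u hu, add_comm]
    rw [← hd]
    refine hh.mem_spanOn_of_isHomogeneous hL (L.mul_mem_left _ (hh.mem u hu)) ?_
    rw [hδ, add_comm]
    exact (isHomogeneous_X K k).mul (hh.isHomogeneous u hu)
  have hu0 : u ≠ 0 := by rintro rfl; simp at hmax
  obtain ⟨v, t, rfl, ht⟩ := exists_eq_add_single_of_ne_zero hu0
  simp only [map_add, Finsupp.degree_single] at hδ
  have hv : v ∈ lowMultiples J δ i := hJ.mem_lowMultiples_of_add_single ht (by omega) hu
  have hti : (t : ℕ) < i := hu.1 t (by simp)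
  have hkt : k < t := by
    by_contra! htk
    refine hmax fun l hl => ?_
    rcases eq_or_ne l t with rfl | hlt
    · exact htk
    · exact (ht l (by simpa [Finsupp.single_apply, hlt.symm] using hl)).trans htk
  have hpos : ∀ w : Fin n →₀ ℕ, w ≺[m] w + Finsupp.single t 1 := fun w =>
    lt_of_le_of_ne (m.toSyn_monotone le_self_add)
      (m.toSyn.injective.ne (by simp))
  have hc' : c = m.toSyn (v + Finsupp.single k 1 + Finsupp.single t 1) := by
    rw [hc, add_right_comm]
  have hvk := ih (m.toSyn (v + Finsupp.single k 1)) (hc' ▸ hpos _) hv hk rfl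
  -- Now `X k * h u` is `X t * (X k * h v)`. Expand the inner product by induction: for the top
  -- exponent `v + single k 1`, `t` is still at least every index, as `k < t`; multiplying the
  -- smaller exponents by `t` stays below the bound, so induction applies again.
  rw [hh.add_single v t (by omega) ht, mul_left_comm, add_right_comm]
  refine X_mul_mem_spanOn (fun w hw => ?_) hvk
  rcases hw.2.eq_or_lt with heq | hlt
  · have hw' := m.toSyn.injective heq
    have hwt : ∀ l ∈ w.support, l ≤ t := by
      intro l hl
      rcases eq_or_ne l k with rfl | hlk
      · exact hkt.le
      · exact ht l (by simpa [hw', Finsupp.single_apply, hlk.symm] using hl)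
    rw [← hh.add_single w t (degree_le_of_mem_lowMultiples hw.1) hwt]
    refine mem_spanOn ⟨add_single_mem_lowMultiples hw.1 hti, ?_⟩
    rw [hw']
  · have hlt' : w + Finsupp.single t 1 ≺[m] v + Finsupp.single k 1 + Finsupp.single t 1 := by
      rw [map_add, map_add _ (v + _)]
      exact add_lt_add_left hlt _
    exact spanOn_mono (lowMultiplesLE_mono hlt'.le) (ih _ (hc' ▸ hlt') hw.1 hti rfl)

lemma X_mul_mem_spanOn_lowMultiples (hh : IsInvolutiveFamily L J δ i h) (hJ : StronglyStable J)
    (hL : ∀ f ∈ L, f ≠ 0 → f.IsHomogeneous (δ + 1) → IsLow i ((degRevLex n).degree f) →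
      (degRevLex n).degree f ∈ lowMultiples J δ i) {f : MvPolynomial (Fin n) K}
    (hf : f ∈ spanOn h i (lowMultiples J δ i)) (k : Fin n) :
    X k * f ∈ spanOn h i (lowMultiples J δ i) := by
  rcases lt_or_ge (k : ℕ) i with hk | hk
  · refine X_mul_mem_spanOn (fun w hw => ?_) hf
    exact spanOn_mono (fun _ hv => hv.1) (hh.X_mul_mem hJ hL hw hk)
  · exact mem_spanOn_of_mem_highIdeal (Ideal.mul_mem_right _ _ (Ideal.subset_span ⟨k, hk, rfl⟩))

/-- The family spans the forms of degree greater than `δ` of `L` modulo the high variables. -/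
lemma mem_spanOn_lowMultiples (hh : IsInvolutiveFamily L J δ i h) (hJ : StronglyStable J)
    (hgen : GeneratedInDegreeLE L (δ + 1))
    (hL : ∀ f ∈ L, f ≠ 0 → f.IsHomogeneous (δ + 1) → IsLow i ((degRevLex n).degree f) →
      (degRevLex n).degree f ∈ lowMultiples J δ i) {f : MvPolynomial (Fin n) K}
    (hf : f ∈ L) {d : ℕ} (hd : δ < d) (hfd : f.IsHomogeneous d) :
    f ∈ spanOn h i (lowMultiples J δ i) := by
  obtain ⟨S, hS, hLS⟩ := hgen
  -- Variables are peeled off `u` until the product has degree `δ + 1`, where `hL` applies; since `e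
  -- ≤ δ + 1`, every product of degree above `δ` reaches that point.
  have hmon : ∀ s ∈ S, ∀ (N : ℕ) (u : Fin n →₀ ℕ) (e : ℕ), u.degree = N → s.IsHomogeneous e →
      e ≤ δ + 1 → δ < N + e → monomial u (1 : K) * s ∈ spanOn h i (lowMultiples J δ i) := by
    intro s hs N
    induction N with
    | zero =>
      intro u e hu hse he hlt
      obtain rfl : e = δ + 1 := by omega
      rw [Finsupp.degree_eq_zero_iff] at hu
      subst hu
      rw [monomial_zero', C_1, one_mul]
      have hsL : s ∈ L := hLS ▸ Ideal.subset_span hs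
      exact spanOn_mono (fun _ hv => hv.1) (hh.mem_spanOn_of_isHomogeneous hL hsL hse)
    | succ N ih =>
      intro u e hu hse he hlt
      rcases eq_or_ne (N + e) δ with hN | hN
      · have hsL : monomial u (1 : K) * s ∈ L := L.mul_mem_left _ (hLS ▸ Ideal.subset_span hs)
        refine spanOn_mono (fun _ hv => hv.1) (hh.mem_spanOn_of_isHomogeneous hL hsL ?_)
        rw [← hN, Nat.add_right_comm]
        exact (isHomogeneous_monomial _ hu).mul hse
      · have hu0 : u ≠ 0 := by rintro rfl; simp at hu
        obtain ⟨v, t, rfl, -⟩ := exists_eq_add_single_of_ne_zero hu0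
        simp only [map_add, Finsupp.degree_single] at hu
        have h1 := ih v e (by omega) hse he (by omega)
        have h2 : monomial (v + Finsupp.single t 1) (1 : K) = X t * monomial v 1 := by
          rw [X, monomial_mul, one_mul, add_comm]
        rw [h2, mul_assoc]
        exact hh.X_mul_mem_spanOn_lowMultiples hJ hL h1 t
  -- The extra monomial `u` absorbs polynomial cofactors in the span induction, and the component
  -- discards other degrees.
  have hcomp : ∀ f ∈ L, ∀ u : Fin n →₀ ℕ,
      homogeneousComponent d (monomial u (1 : K) * f) ∈ spanOn h i (lowMultiples J δ i) := by
    intro f hf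
    rw [hLS] at hf
    induction hf using Submodule.span_induction with
    | zero => simp
    | add p q _ _ hp hq =>
      intro u
      rw [mul_add, map_add]
      exact add_mem (hp u) (hq u)
    | mem s hs =>
      intro u
      obtain ⟨e, he, hse⟩ := hS s hs
      rw [homogeneousComponent_of_mem ((isHomogeneous_monomial (1 : K) rfl).mul hse)]
      split_ifs with hde
      · exact hmon s hs _ u e rfl hse he (by omega)
      · exact zero_mem _
    | smul p s _ hs =>
      intro u
      induction p using MvPolynomial.induction_on' with
      | monomial v a =>
        have h1 : monomial u (1 : K) * (monomial v a • s) =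
            C a * (monomial (u + v) (1 : K) * s) := by
          rw [smul_eq_mul, ← mul_assoc, ← mul_assoc, monomial_mul, C_mul_monomial, one_mul, mul_one]
        rw [h1, homogeneousComponent_C_mul, ← smul_eq_C_mul]
        exact Submodule.smul_mem _ _ (hs _)
      | add p q hp hq =>
        rw [add_smul, mul_add, map_add]
        exact add_mem hp hq
  have h1 := hcomp f hf 0
  rwa [monomial_zero', C_1, one_mul, homogeneousComponent_eq_self hfd] at h1

/-- Nonzero linear combinations of the family have their leading monomial among those of the
family. -/
lemma degree_mem_of_mem_span (hh : IsInvolutiveFamily L J δ i h) {f : MvPolynomial (Fin n) K}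
    (hf : f ∈ Submodule.span K (h '' lowMultiples J δ i)) (hf0 : f ≠ 0) :
    (degRevLex n).degree f ∈ lowMultiples J δ i := by
  set m := degRevLex n with hm
  obtain ⟨l, hl, rfl⟩ := (Finsupp.mem_span_image_iff_linearCombination K).1 hf
  have hl0 : l ≠ 0 := by rintro rfl; simp at hf0
  obtain ⟨w, hw, hmax⟩ := l.support.exists_max_image m.toSyn (Finsupp.support_nonempty_iff.2 hl0)
  rw [Finsupp.mem_supported] at hl
  have hwE : w ∈ lowMultiples J δ i := hl hw
  have hle : m.degree (Finsupp.linearCombination K h l) ≼[m] w := by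
    rw [Finsupp.linearCombination_apply, Finsupp.sum]
    refine m.degree_sum_le.trans (Finset.sup_le fun v hv => m.degree_smul_le.trans ?_)
    rw [hh.degree_eq v (hl hv)]
    exact hmax v hv
  have hc : coeff w (Finsupp.linearCombination K h l) = l w := by
    rw [Finsupp.linearCombination_apply, Finsupp.sum, coeff_sum, Finset.sum_eq_single w]
    · have h1 := (hh.monic w hwE).coeff_degree
      rw [hh.degree_eq w hwE] at h1
      rw [coeff_smul, h1, smul_eq_mul, mul_one]
    · intro v hv hvw
      rw [coeff_smul, m.coeff_eq_zero_of_lt, smul_zero]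
      rw [hh.degree_eq v (hl hv)]
      exact lt_of_le_of_ne (hmax v hv) (m.toSyn.injective.ne hvw)
    · intro h0
      exact absurd hw h0
  have hge : w ≼[m] m.degree (Finsupp.linearCombination K h l) := by
    apply m.le_degree
    rw [mem_support_iff, hc]
    exact Finsupp.mem_support_iff.1 hw
  rwa [m.toSyn.injective (le_antisymm hle hge)]

/-- Low leading monomials of elements of the span are leading monomials of the family. -/
lemma degree_mem_of_mem_spanOn (hh : IsInvolutiveFamily L J δ i h) {f : MvPolynomial (Fin n) K}
    (hf : f ∈ spanOn h i (lowMultiples J δ i)) (hf0 : f ≠ 0)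
    (hlow : IsLow i ((degRevLex n).degree f)) :
    (degRevLex n).degree f ∈ lowMultiples J δ i := by
  set m := degRevLex n with hm
  obtain ⟨p, hp, r, hr, rfl⟩ := Submodule.mem_sup.1 hf
  have hr' : ∀ v, IsLow i v → coeff v (p + r) = coeff v p := by
    intro v hv
    have : coeff v r = 0 := by
      by_contra h0
      exact mem_highIdeal_iff.1 hr v (mem_support_iff.2 h0) hv
    rw [coeff_add, this, add_zero]
  have h1 : coeff (m.degree (p + r)) p ≠ 0 := by
    rw [← hr' _ hlow]
    exact m.coeff_degree_ne_zero_iff.2 hf0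
  have hp0 : p ≠ 0 := by rintro rfl; simp at h1
  have hpE := hh.degree_mem_of_mem_span hp hp0
  have h2 : coeff (m.degree p) (p + r) ≠ 0 := by
    rw [hr' _ hpE.1]
    exact m.coeff_degree_ne_zero_iff.2 hp0
  -- Both leading monomials are low, and `p` and `p + r` agree on low monomials, so each occurs in
  -- the other polynomial.
  have heq : m.degree (p + r) = m.degree p := m.toSyn.injective
    (le_antisymm (m.le_degree (mem_support_iff.2 h1)) (m.le_degree (mem_support_iff.2 h2)))
  rw [heq]
  exact hpE

end IsInvolutiveFamily

/-- A monomial that is divisible by a smaller one from `J` has a divisor from `J` of any degree in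
between. -/
lemma mem_lowMultiples_of_le {u v : Fin n →₀ ℕ} (hu : IsLow i u) (hvu : v ≤ u)
    (hv : monomial v (1 : K) ∈ J) (hvδ : v.degree ≤ δ) (hδu : δ ≤ u.degree) :
    u ∈ lowMultiples J δ i := by
  obtain ⟨c, rfl⟩ := exists_add_of_le hvu
  rw [map_add] at hδu
  obtain ⟨b, hbc, hb⟩ : ∃ b ≤ c, b.degree = δ - v.degree :=
    Finsupp.exists_le_degree_eq c (δ - v.degree) (by omega)
  refine ⟨hu, v + b, add_le_add_right hbc v, by rw [map_add]; omega, ?_⟩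
  have := J.mul_mem_left (monomial b 1) hv
  rwa [monomial_mul, one_mul, add_comm] at this

lemma IsRgin.stronglyStable [CharZero K] {I : Ideal (MvPolynomial (Fin n) K)} {e : ℕ}
    (hI : GeneratedInDegreeLE I e) (hJ : IsRgin I J) : StronglyStable J := by
  intro j t hjt b hb
  refine IsGin.monomial_add_single_mem hI hJ ?_ hb
  refine degRevLex_lt_iff.2 (Or.inr ⟨by simp, t, fun k hk => ?_, ?_⟩)
  · simp [hk.ne, (hjt.trans hk).ne]
  · simp [hjt.ne]

end Crystallization

theorem lemma4p2 {K : Type*} [Field K] [CharZero K] {n : ℕ}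
    (I J : Ideal (MvPolynomial (Fin n) K))
    (hI : IsHomogeneousIdeal I)
    (hJ : IsRgin I J)
    (δ : ℕ) (hδ : GeneratedInDegreeLE I (δ + 1))
    (i : ℕ) (hi : i ≤ n)
    (h : ¬ HasMinimalGeneratorIn J i (δ + 1)) :
    ∀ d : ℕ, δ < d → ¬ HasMinimalGeneratorIn J i d := by
  rintro d hd ⟨u, hu, hud, hlow⟩
  have hst := hJ.stronglyStable hδ
  obtain ⟨U, -, ⟨g, hg⟩, hUJ⟩ := hJ
  have hgen := hδ.map_changeCoords g
  have hin := hUJ g hg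
  have hex : ∀ v, monomial v (1 : K) ∈ J → ∃ f ∈ I.map (changeCoords g),
      f.IsHomogeneous v.degree ∧ (degRevLex n).Monic f ∧ (degRevLex n).degree f = v := by
    intro v hv
    rw [← hin] at hv
    exact exists_monic_form_of_mem_initialIdeal hgen.homogeneousComponent_mem hv
  obtain ⟨F, hF⟩ := hst.exists_isInvolutiveFamily (δ := δ) (i := i) hex
  have hL : ∀ f ∈ I.map (changeCoords g), f ≠ 0 → f.IsHomogeneous (δ + 1) →
      IsLow i ((degRevLex n).degree f) → (degRevLex n).degree f ∈ lowMultiples J δ i := by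
    intro f hf hf0 hfd hflow
    have hfJ : monomial ((degRevLex n).degree f) (1 : K) ∈ J :=
      hin ▸ monomial_degree_mem_initialIdeal hf hf0
    have hdeg : ((degRevLex n).degree f).degree = δ + 1 :=
      (hfd.degree_eq_sum_deg_support ((degRevLex n).degree_mem_support hf0)).symm
    -- By `h` this low monomial is not minimal in `J`, so it has a proper divisor there; that
    -- divisor has degree at most `δ` and can be enlarged to degree exactly `δ`.
    obtain ⟨v, hv, hvJ⟩ : ∃ v < (degRevLex n).degree f, monomial v (1 : K) ∈ J := by
      by_contra! hmin
      refine h ⟨_, ⟨hfJ, fun v hv hle => ?_⟩, hdeg, hflow⟩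
      by_contra hnle
      exact hmin v (lt_of_le_not_ge hle hnle) hv
    have hvdeg : v.degree < ((degRevLex n).degree f).degree := by
      obtain ⟨c, hc⟩ := exists_add_of_le hv.le
      have hc0 : c.degree ≠ 0 := by
        rw [Ne, Finsupp.degree_eq_zero_iff]
        rintro rfl
        exact hv.ne' (by simpa using hc)
      rw [hc, map_add]
      omega
    exact mem_lowMultiples_of_le hflow hv.le hvJ (by omega) (by omega)
  obtain ⟨f, hf, hfd, hfm, hfu⟩ := hex u hu.prop
  have hmem := hF.mem_spanOn_lowMultiples hst hgen hL hf (by omega) hfd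
  have huE := hF.degree_mem_of_mem_spanOn hmem hfm.ne_zero (hfu ▸ hlow)
  rw [hfu] at huE
  obtain ⟨-, a, hau, had, haJ⟩ := huE
  -- Minimality of `u` against its divisor `a` in `J` would force `d ≤ δ`.
  have := Finsupp.degree_mono (hu.le_of_le haJ hau)
  omega
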